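/- **Conventions.** Topological groups are not assumed Hausdorff. Let $G$ be a topological group and $A$ an abelian topological $G$-module, i.e. an abelian topological group, written multiplicatively, with an action $G\times A\to A$, $(g,a)\mapsto {}^{g}a$, by group automorphisms that is jointly continuous. *Cohomology.* $H^2(G,A)$ (in Hu's sense) is the group of continuous maps $f:G\times G\to A$ satisfying ${}^{g}f(h,k)\,f(g,hk)=f(gh,k)\,f(g,h)$ for all $g,h,k\in G$, modulo the maps $(g,h)\mapsto {}^{g}c(h)\,c(gh)^{-1}c(g)$ with $c:G\to A$ continuous. *Extensions.* $\mathrm{Opext}_s(G,A)$ is the set of equivalence classes of short exact sequences of topological groups $1\to A\xrightarrow{\chi}E\xrightarrow{\pi}G\to1$ such that $\chi$ is a homeomorphic embedding, $\pi$ is continuous and open and admits a continuous section, and $\chi({}^{\pi(x)}a)=x\chi(a)x^{-1}$ for all $x\in E$, $a\in A$. Two such extensions are equivalent if there is a continuous homomorphism between the middle groups inducing the identity on $A$ and on $G$. A *factor set* of such an extension is a map $f:G\times G\to A$ with $s(g)s(h)=\chi(f(g,h))\,s(gh)$ for some continuous section $s$ of $\pi$. *Standard projective simplicial kernel.* A topological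 group $P$ is *projective* if, for every continuous epimorphism $\pi:X\to Y$ of topological groups having a continuous section (not necessarily a homomorphism), every continuous homomorphism $P\to Y$ lifts along $\pi$ to a continuous homomorphism $P\to X$. A standard projective simplicial kernel $(M,\iota_0,\iota_1,\tau)$ of $G$ consists of a continuous epimorphism $\tau:P\to G$ with $P$ projective that has a continuous section $s:G\to P$, the topological subgroup $M=\{(x,y)\in P\times P:\tau(x)=\tau(y)\}$ of $P\times P$, and the two projections $\iota_0,\iota_1:M\to P$. *The quotient.* Regard $A$ as a $P$-module via $\tau$ and as an $M$-module via $\tau\iota_0=\tau\iota_1$. Let $\mathrm{Der}_c(P,A)$ be the group, under pointwise multiplication, of continuous maps $\gamma:P\to A$ with $\gamma(xy)=\gamma(x)\,{}^{x}\gamma(y)$, and define $\mathrm{Der}_c(M,A)$ in the same way. Put $Z^1(M,A)=\{\alpha\in \mathrm{Der}_c(M,A):\alpha(x,x)=1\text{ for all }x\in P\}$. Let $\eta:\mathrm{Der}_c(P,A)\to Z^1(M,A)$ be the homomorphism $\eta(\gamma)=(\gamma\iota_0)(\gamma\iota_1)^{-1}$, and write $\alpha\sim\beta$ if $\beta=\eta(\gamma)\alpha$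 for some $\gamma\in\mathrm{Der}_c(P,A)$. *The extension of $\alpha$.* Give $A\rtimes P$ the product topology and the multiplication $(a,x)(b,y)=(a\,{}^{x}b,xy)$. For $\alpha\in Z^1(M,A)$ let $N_\alpha=\{(a,x)\in A\rtimes P:\tau(x)=1,\ a=\alpha(1,x)\}$, a normal subgroup. Let $e_\alpha$ be the extension $$1\to A\xrightarrow{\ a\mapsto(a,1)N_\alpha\ }(A\rtimes P)/N_\alpha\xrightarrow{\ (a,x)N_\alpha\mapsto\tau(x)\ }G\to1,$$ which represents an element $[e_\alpha]$ of $\mathrm{Opext}_s(G,A)$. **Theorem 2.1.** Let $A$ be an abelian topological $G$-module and $(M,\iota_0,\iota_1,\tau)$ a standard projective simplicial kernel of $G$. Then $H^2(G,A)$ is canonically isomorphic to $Z^1(M,A)/{\sim}$. Precisely, there are a bijection $\Psi:\mathrm{Opext}_s(G,A)\to H^2(G,A)$ such that, for every such extension $e$ and every continuous $2$-cocycle $f$, one has $\Psi([e])=[f]$ if and only if $f$ is a factor set of $e$, and a group isomorphism $\Phi:Z^1(M,A)/{\sim}\;\to H^2(G,A)$ with $\Phi([\alpha])=\Psi([e_\alpha])$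 for all $\alpha\in Z^1(M,A)$. -/

import Mathlib

universe u

namespace HuCohomology

open Topology

set_option linter.unusedSectionVars false

/-! ### Continuous crossed homomorphisms -/

section Derivations

variable {G H : Type*} [Group G] [TopologicalSpace G] [Group H] [TopologicalSpace H]

/-- `Der_c(H, A)`: the group (under pointwise multiplication) of continuous crossed homomorphisms
`H → A`, where the abelian topological `G`-module `A` is regarded as an `H`-module through the
continuous homomorphism `φ : H → G`. -/
def Der (φ : H →ₜ* G) (A : Type*) [CommGroup A] [TopologicalSpace A] [IsTopologicalGroup A]
    [MulDistribMulAction G A] : Subgroup C(H, A) where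
  carrier := {f | ∀ x y : H, f (x * y) = f x * φ x • f y}
  mul_mem' := by
    intro f g hf hg x y
    simp only [ContinuousMap.mul_apply, hf x y, hg x y, smul_mul']
    exact mul_mul_mul_comm _ _ _ _
  one_mem' := by intro x y; simp
  inv_mem' := by
    intro f hf x y
    simp only [ContinuousMap.inv_apply, hf x y, smul_inv', mul_inv]

end Derivations

/-! ### Second cohomology by continuous inhomogeneous cochains -/

section Hu

variable (G A : Type*) [Group G] [TopologicalSpace G] [IsTopologicalGroup G]
  [CommGroup A] [TopologicalSpace A] [IsTopologicalGroup A]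
  [MulDistribMulAction G A] [ContinuousSMul G A]

/-- The coboundary `C¹(G, A) → C²(G, A)` on continuous cochains (`A` written multiplicatively). -/
def d₁ : C(G, A) →* C(G × G, A) where
  toFun c := ⟨fun p => p.1 • c p.2 * (c (p.1 * p.2))⁻¹ * c p.1, by fun_prop⟩
  map_one' := by ext p; simp
  map_mul' c c' := by
    ext p
    simp only [ContinuousMap.mul_apply, ContinuousMap.coe_mk, smul_mul', mul_inv]
    simp only [mul_assoc, mul_left_comm, mul_comm]

/-- The coboundary `C²(G, A) → C³(G, A)` on continuous cochains (`A` written multiplicatively). -/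
def d₂ : C(G × G, A) →* C(G × G × G, A) where
  toFun f := ⟨fun p => p.1 • f (p.2.1, p.2.2) * (f (p.1 * p.2.1, p.2.2))⁻¹ *
    f (p.1, p.2.1 * p.2.2) * (f (p.1, p.2.1))⁻¹, by fun_prop⟩
  map_one' := by ext p; simp
  map_mul' f f' := by
    ext p
    simp only [ContinuousMap.mul_apply, ContinuousMap.coe_mk, smul_mul', mul_inv]
    simp only [mul_assoc, mul_left_comm, mul_comm]

/-- Continuous 2-cocycles. -/
abbrev Z2 : Subgroup C(G × G, A) := (d₂ G A).ker

/-- Continuous 2-coboundaries. -/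
abbrev B2 : Subgroup C(G × G, A) := (d₁ G A).range

theorem B2_le_Z2 : B2 G A ≤ Z2 G A := by
  rintro _ ⟨c, rfl⟩
  rw [MonoidHom.mem_ker]
  ext ⟨g, h, k⟩
  simp only [d₁, d₂, MonoidHom.coe_mk, OneHom.coe_mk, ContinuousMap.coe_mk, ContinuousMap.one_apply,
    smul_mul', smul_inv', smul_smul, mul_inv, inv_inv, mul_assoc g h k]
  generalize (g * h) • c k = a1
  generalize g • c (h * k) = a2
  generalize g • c h = a3
  generalize c (g * (h * k)) = a4
  generalize c (g * h) = a5
  generalize c g = a6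
  rw [← Additive.ofMul.injective.eq_iff]
  simp only [ofMul_mul, ofMul_inv, ofMul_one]
  abel

/-- `H²(G, A)`: continuous 2-cocycles modulo continuous 2-coboundaries. -/
abbrev H2 : Type _ := Z2 G A ⧸ (B2 G A).subgroupOf (Z2 G A)

end Hu

/-! ### Proper extensions with continuous sections -/

section Extensions

variable (G A : Type u) [Group G] [TopologicalSpace G]
  [CommGroup A] [TopologicalSpace A] [MulDistribMulAction G A]

/-- `opext_s(G, A)`: extensions of topological groups `1 → A → E → G → 1` in which `A → E` is a
homeomorphic embedding and `E → G` is continuous and open, which admit a continuous section and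
which induce the given action of `G` on `A`. -/
structure ProperExt where
  E : Type u
  [group : Group E]
  [top : TopologicalSpace E]
  [topGroup : IsTopologicalGroup E]
  toExt : GroupExtension A E G
  isEmbedding_inl : IsEmbedding toExt.inl
  continuous_rightHom : Continuous toExt.rightHom
  isOpenMap_rightHom : IsOpenMap toExt.rightHom
  exists_section : ∃ s : G → E, Continuous s ∧ ∀ g, toExt.rightHom (s g) = g
  inl_smul : ∀ (e : E) (a : A), toExt.inl (toExt.rightHom e • a) = e * toExt.inl a * e⁻¹

attribute [instance] ProperExt.group ProperExt.top ProperExt.topGroup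

variable {G A}

namespace ProperExt

/-- Two extensions are equivalent if there is a continuous homomorphism between them which is the
identity on `A` and on `G`. -/
def Equivalent (e₀ e₁ : ProperExt G A) : Prop :=
  ∃ θ : e₀.E →ₜ* e₁.E, (∀ a, θ (e₀.toExt.inl a) = e₁.toExt.inl a) ∧
    ∀ x, e₁.toExt.rightHom (θ x) = e₀.toExt.rightHom x

theorem Equivalent.symm {e₀ e₁ : ProperExt G A} (h : e₀.Equivalent e₁) : e₁.Equivalent e₀ := by
  obtain ⟨θ, hA, hG⟩ := h
  have hinj : Function.Injective θ := by
    refine (injective_iff_map_eq_one θ).2 fun x hx => ?_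
    have h1 : x ∈ e₀.toExt.rightHom.ker := by
      rw [MonoidHom.mem_ker, ← hG, hx, map_one]
    rw [← e₀.toExt.range_inl_eq_ker_rightHom] at h1
    obtain ⟨a, rfl⟩ := h1
    rw [hA] at hx
    have : a = 1 := e₁.toExt.inl_injective (by rw [hx, map_one])
    rw [this, map_one]
  obtain ⟨s, hs, hsG⟩ := e₀.exists_section
  have hmem : ∀ y : e₁.E, y * (θ (s (e₁.toExt.rightHom y)))⁻¹ ∈ Set.range e₁.toExt.inl := by
    intro y
    have : y * (θ (s (e₁.toExt.rightHom y)))⁻¹ ∈ e₁.toExt.rightHom.ker := by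
      rw [MonoidHom.mem_ker, map_mul, map_inv, hG, hsG, mul_inv_cancel]
    rw [← e₁.toExt.range_inl_eq_ker_rightHom] at this
    exact this
  choose a ha using hmem
  have hac : Continuous a := by
    rw [e₁.isEmbedding_inl.continuous_iff]
    have : (e₁.toExt.inl ∘ a) = fun y => y * (θ (s (e₁.toExt.rightHom y)))⁻¹ := funext ha
    rw [this]
    have h1 := e₁.continuous_rightHom
    have h2 := θ.continuous_toFun
    exact continuous_id.mul (h2.comp (hs.comp h1)).inv
  let ξ : e₁.E → e₀.E := fun y => e₀.toExt.inl (a y) * s (e₁.toExt.rightHom y)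
  have hξ : ∀ y, θ (ξ y) = y := by
    intro y
    simp only [ξ, map_mul, hA, ha, inv_mul_cancel_right]
  refine ⟨⟨⟨⟨ξ, hinj ?_⟩, fun x y => hinj ?_⟩, ?_⟩, fun b => hinj ?_, fun y => ?_⟩
  · rw [hξ, map_one]
  · simp [hξ]
  · exact (e₀.isEmbedding_inl.continuous.comp hac).mul (hs.comp e₁.continuous_rightHom)
  · exact (hξ _).trans (hA b).symm
  · change e₀.toExt.rightHom (ξ y) = _
    rw [← hG, hξ]

instance setoid : Setoid (ProperExt G A) where
  r := Equivalent
  iseqv :=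
    { refl := fun e => ⟨ContinuousMonoidHom.id e.E, fun _ => rfl, fun _ => rfl⟩
      symm := Equivalent.symm
      trans := by
        rintro e₀ e₁ e₂ ⟨θ, hA, hG⟩ ⟨θ', hA', hG'⟩
        exact ⟨θ'.comp θ, fun a => by simp [hA, hA'], fun x => by simp [hG, hG']⟩ }

/-- `f` is the factor set of the extension `e` with respect to some continuous section `s`, i.e.
`s(g) s(h) = f(g, h) s(gh)`. -/
def IsFactorSet (e : ProperExt G A) (f : C(G × G, A)) : Prop :=
  ∃ s : G → e.E, Continuous s ∧ (∀ g, e.toExt.rightHom (s g) = g) ∧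
    ∀ g h, s g * s h = e.toExt.inl (f (g, h)) * s (g * h)

end ProperExt

variable (G A)

/-- `Opext_s(G, A)`: equivalence classes of proper extensions with continuous sections. -/
abbrev Opext : Type (u + 1) := Quotient (ProperExt.setoid (G := G) (A := A))

end Extensions

/-! ### Projective topological groups and simplicial kernels -/

section Kernels

/-- Projective topological group: continuous homomorphisms out of `P` lift along every continuous
epimorphism which has a continuous (not necessarily homomorphic) section. -/
def IsProjectiveGroup (P : Type u) [Group P] [TopologicalSpace P] : Prop :=
  ∀ (X Y : Type u) [Group X] [TopologicalSpace X] [IsTopologicalGroup X]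
    [Group Y] [TopologicalSpace Y] [IsTopologicalGroup Y] (π : X →ₜ* Y),
    Function.Surjective π → (∃ s : Y → X, Continuous s ∧ ∀ y, π (s y) = y) →
    ∀ f : P →ₜ* Y, ∃ g : P →ₜ* X, ∀ x, π (g x) = f x

variable {M P G : Type u} [Group M] [TopologicalSpace M] [Group P] [TopologicalSpace P]
  [Group G] [TopologicalSpace G]

/-- `(M, ι₀, ι₁)` is a simplicial kernel of `τ`. -/
structure IsSimplicialKernel (ι₀ ι₁ : M →ₜ* P) (τ : P →ₜ* G) : Prop where
  comm : ∀ m, τ (ι₀ m) = τ (ι₁ m)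
  universal : ∀ (K : Type u) [Group K] [TopologicalSpace K] [IsTopologicalGroup K]
    (j₀ j₁ : K →ₜ* P), (∀ k, τ (j₀ k) = τ (j₁ k)) →
    ∃! h : K →ₜ* M, (∀ k, ι₀ (h k) = j₀ k) ∧ ∀ k, ι₁ (h k) = j₁ k

/-- `(M, ι₀, ι₁, τ)` is a projective simplicial kernel of `G`. -/
structure IsProjectiveSimplicialKernel (ι₀ ι₁ : M →ₜ* P) (τ : P →ₜ* G) : Prop where
  isSimplicialKernel : IsSimplicialKernel ι₀ ι₁ τ
  projective : IsProjectiveGroup P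
  surjective : Function.Surjective τ
  exists_section : ∃ s : G → P, Continuous s ∧ ∀ g, τ (s g) = g

/-- The group `M = {(x, y) | τ x = τ y}` of the standard simplicial kernel of `τ`, a topological
subgroup of `P × P`. -/
def stdKernel (τ : P →ₜ* G) : Subgroup (P × P) where
  carrier := {p | τ p.1 = τ p.2}
  mul_mem' := by
    intro a b ha hb
    simp only [Set.mem_ofPred_eq] at ha hb
    simp [ha, hb]
  one_mem' := by simp
  inv_mem' := by
    intro a ha
    simp only [Set.mem_ofPred_eq] at ha
    simp [ha]

/-- First projection `M → P`. -/
def proj₀ (τ : P →ₜ* G) : stdKernel τ →ₜ* P where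
  toFun m := m.1.1
  map_one' := rfl
  map_mul' _ _ := rfl
  continuous_toFun := by fun_prop

/-- Second projection `M → P`. -/
def proj₁ (τ : P →ₜ* G) : stdKernel τ →ₜ* P where
  toFun m := m.1.2
  map_one' := rfl
  map_mul' _ _ := rfl
  continuous_toFun := by fun_prop

/-- The standard triple really is a simplicial kernel of `τ`. -/
theorem isSimplicialKernel_std (τ : P →ₜ* G) :
    IsSimplicialKernel (proj₀ τ) (proj₁ τ) τ where
  comm m := m.2
  universal K _ _ _ j₀ j₁ hj := by
    refine ⟨⟨⟨⟨fun k => ⟨(j₀ k, j₁ k), hj k⟩, ?_⟩, ?_⟩, ?_⟩, ⟨fun k => rfl, fun k => rfl⟩, ?_⟩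
    · ext <;> simp
    · intro x y; ext <;> simp
    · have h0 := j₀.continuous_toFun
      have h1 := j₁.continuous_toFun
      exact (h0.prodMk h1).subtype_mk _
    · rintro h ⟨h0, h1⟩
      ext k
      · exact h0 k
      · exact h1 k

end Kernels

/-! ### The group `Z¹(M, A)` and the map `η` -/

section Z1

variable {P G : Type u} [Group P] [TopologicalSpace P] [Group G] [TopologicalSpace G]
  (τ : P →ₜ* G)
  (A : Type u) [CommGroup A] [TopologicalSpace A] [IsTopologicalGroup A] [MulDistribMulAction G A]

/-- `Z¹(M, A)`: the continuous crossed homomorphisms on `M` (acting on `A` through `τ ι₀ = τ ι₁`)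
which are trivial on the diagonal of `P`. -/
def Z1 : Subgroup (Der (τ.comp (proj₀ τ)) A) where
  carrier := {α | ∀ x : P, α.1 ⟨(x, x), rfl⟩ = 1}
  mul_mem' := by
    intro a b ha hb x
    change a.1 _ * b.1 _ = 1
    rw [ha x, hb x, mul_one]
  one_mem' := fun _ => rfl
  inv_mem' := by
    intro a ha x
    change (a.1 _)⁻¹ = 1
    rw [ha x, inv_one]

/-- `η(γ) = (γ ι₀)(γ ι₁)⁻¹`. -/
def η : Der τ A →* Z1 τ A where
  toFun γ := ⟨⟨⟨fun m => γ.1 (proj₀ τ m) * (γ.1 (proj₁ τ m))⁻¹, by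
      have h0 := (proj₀ τ).continuous_toFun
      have h1 := (proj₁ τ).continuous_toFun
      exact (γ.1.continuous.comp h0).mul (γ.1.continuous.comp h1).inv⟩, by
      intro x y
      have hx : τ (proj₁ τ x) = τ (proj₀ τ x) := x.2.symm
      have e0 := γ.2 (proj₀ τ x) (proj₀ τ y)
      have e1 := γ.2 (proj₁ τ x) (proj₁ τ y)
      rw [hx] at e1
      simp only [ContinuousMap.coe_mk, map_mul, e0, e1, ContinuousMonoidHom.comp_toFun,
        smul_mul', smul_inv', mul_inv]
      exact mul_mul_mul_comm _ _ _ _⟩, fun x => mul_inv_cancel _⟩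
  map_one' := by
    ext m
    exact mul_inv_cancel (1 : A)
  map_mul' γ γ' := by
    ext m
    change (γ.1 _ * γ'.1 _) * (γ.1 _ * γ'.1 _)⁻¹ = (γ.1 _ * (γ.1 _)⁻¹) * (γ'.1 _ * (γ'.1 _)⁻¹)
    rw [mul_inv]
    exact mul_mul_mul_comm _ _ _ _

end Z1

/-! ### The extension attached to an element of `Z¹(M, A)` -/

section Semidirect

/-- The topology of the topological semidirect product: the product topology. -/
instance instTopologicalSpaceSemidirectProduct {N H : Type*} [Group N] [Group H]
    [TopologicalSpace N] [TopologicalSpace H] (φ : H →* MulAut N) :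
    TopologicalSpace (N ⋊[φ] H) :=
  TopologicalSpace.induced SemidirectProduct.equivProd inferInstance

variable {P G : Type u} [Group P] [TopologicalSpace P] [IsTopologicalGroup P]
  [Group G] [TopologicalSpace G]
  (τ : P →ₜ* G)
  (A : Type u) [CommGroup A] [TopologicalSpace A] [IsTopologicalGroup A] [MulDistribMulAction G A]

/-- The action of `P` on `A` through `τ`. -/
def act : P →* MulAut A := (MulDistribMulAction.toMulAut G A).comp (τ : P →* G)

theorem act_apply (x : P) (a : A) : act τ A x a = τ x • a := rfl

theorem smul_act_inv (x : P) (a : A) : τ x • act τ A x⁻¹ a = a := by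
  rw [act_apply, map_inv, smul_inv_smul]

/-- The topological semidirect product `A ⋊ P`. -/
abbrev Semi : Type u := A ⋊[act τ A] P

theorem continuous_semi_iff {X : Type*} [TopologicalSpace X] (f : X → Semi τ A) :
    Continuous f ↔ Continuous (fun x => (f x).left) ∧ Continuous (fun x => (f x).right) := by
  rw [continuous_induced_rng, continuous_prodMk.symm]
  rfl

theorem continuous_left : Continuous (fun p : Semi τ A => p.left) :=
  ((continuous_semi_iff τ A id).1 continuous_id).1

theorem continuous_right : Continuous (fun p : Semi τ A => p.right) :=
  ((continuous_semi_iff τ A id).1 continuous_id).2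

instance [ContinuousSMul G A] : IsTopologicalGroup (Semi τ A) where
  continuous_mul := by
    have hl := continuous_left τ A
    have hr := continuous_right τ A
    have hτ := τ.continuous_toFun
    rw [continuous_semi_iff]
    exact ⟨(hl.comp continuous_fst).mul
      ((hτ.comp (hr.comp continuous_fst)).smul (hl.comp continuous_snd)),
      (hr.comp continuous_fst).mul (hr.comp continuous_snd)⟩
  continuous_inv := by
    have hl := continuous_left τ A
    have hr := continuous_right τ A
    have hτ := τ.continuous_toFun
    rw [continuous_semi_iff]
    exact ⟨(hτ.comp hr.inv).smul hl.inv, hr.inv⟩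

variable {A} {τ}

theorem Z1_comp (α : Z1 τ A) {x y z : P} (hxy : τ x = τ y) (hyz : τ y = τ z) :
    α.1.1 ⟨(x, y), hxy⟩ * α.1.1 ⟨(y, z), hyz⟩ = α.1.1 ⟨(x, z), hxy.trans hyz⟩ := by
  have h1 : τ 1 = τ (y⁻¹ * z) := by simp [hyz]
  have e1 := α.1.2 ⟨(x, y), hxy⟩ ⟨(1, y⁻¹ * z), h1⟩
  have e2 := α.1.2 ⟨(y, y), rfl⟩ ⟨(1, y⁻¹ * z), h1⟩
  have a1 : (⟨(x, y), hxy⟩ * ⟨(1, y⁻¹ * z), h1⟩ : stdKernel τ) = ⟨(x, z), hxy.trans hyz⟩ := by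
    ext <;> simp
  have a2 : (⟨(y, y), rfl⟩ * ⟨(1, y⁻¹ * z), h1⟩ : stdKernel τ) = ⟨(y, z), hyz⟩ := by
    ext <;> simp
  rw [a1] at e1
  rw [a2, α.2 y, one_mul] at e2
  rw [e1, e2]
  congr 2
  exact hxy.symm

theorem Z1_mul (α : Z1 τ A) {x x' y y' : P} (hx : τ x = τ x') (hy : τ y = τ y') :
    α.1.1 ⟨(x * y, x' * y'), (stdKernel τ).mul_mem (x := (x, x')) (y := (y, y')) hx hy⟩ =
      α.1.1 ⟨(x, x'), hx⟩ * τ x • α.1.1 ⟨(y, y'), hy⟩ :=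
  α.1.2 ⟨(x, x'), hx⟩ ⟨(y, y'), hy⟩

/-- The subgroup `N_α = {(a, x) | τ x = 1, a = α(1, x)}` of `A ⋊ P`. -/
def N (α : Z1 τ A) : Subgroup (Semi τ A) where
  carrier := {p | ∃ h : τ 1 = τ p.right, p.left = α.1.1 ⟨(1, p.right), h⟩}
  one_mem' := ⟨rfl, (α.2 1).symm⟩
  mul_mem' := by
    rintro p q ⟨hp, ep⟩ ⟨hq, eq⟩
    have h : τ 1 = τ (p * q).right := by simp [← hp, ← hq]
    refine ⟨h, ?_⟩
    have e := Z1_mul α hp hq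
    simp only [map_one, one_smul, mul_one] at e
    rw [SemidirectProduct.mul_left, act_apply, ← hp, map_one, one_smul, ep, eq]
    exact e.symm
  inv_mem' := by
    rintro p ⟨hp, ep⟩
    have h : τ 1 = τ p⁻¹.right := by simp [← hp]
    refine ⟨h, ?_⟩
    have e := Z1_mul α hp h
    simp only [SemidirectProduct.inv_right, mul_one, mul_inv_cancel, map_one, one_smul] at e
    rw [α.2 1] at e
    rw [SemidirectProduct.inv_left, act_apply, map_inv, ← hp, map_one, inv_one, one_smul, ep]
    exact inv_eq_of_mul_eq_one_right e.symm

theorem mem_N (α : Z1 τ A) (p : Semi τ A) :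
    p ∈ N α ↔ ∃ h : τ 1 = τ p.right, p.left = α.1.1 ⟨(1, p.right), h⟩ := Iff.rfl

instance (α : Z1 τ A) : (N α).Normal where
  conj_mem := by
    rintro p ⟨hp, ep⟩ q
    have h : τ 1 = τ (q * p * q⁻¹).right := by simp [← hp]
    refine ⟨h, ?_⟩
    have hq : τ (q.right * 1) = τ (q.right * p.right) := by simp [← hp]
    have e1 := Z1_mul α (rfl : τ q.right = τ q.right) hp
    have e2 := Z1_mul α hq (rfl : τ q.right⁻¹ = τ q.right⁻¹)
    rw [α.2 q.right⁻¹, smul_one] at e2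
    replace e2 := e2.trans ((mul_one _).trans e1)
    rw [α.2 q.right, one_mul] at e2
    simp only [mul_one, mul_inv_cancel] at e2
    have e3 : (q * p * q⁻¹).left = τ q.right • p.left := by
      rw [SemidirectProduct.mul_left, SemidirectProduct.inv_left, act_apply,
        SemidirectProduct.mul_right, map_mul, ← hp, map_one, mul_one, smul_act_inv,
        SemidirectProduct.mul_left, act_apply]
      rw [mul_right_comm, mul_inv_cancel, one_mul]
    rw [e3, ep]
    exact e2.symm

theorem left_mul_eq (α : Z1 τ A) {p q : Semi τ A} (h : p⁻¹ * q ∈ N α) :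
    ∃ hτ : τ p.right = τ q.right, p.left * α.1.1 ⟨(p.right, q.right), hτ⟩ = q.left := by
  obtain ⟨h1, h2⟩ := h
  have hτ : τ p.right = τ q.right := by
    simpa [eq_inv_mul_iff_mul_eq] using h1
  refine ⟨hτ, ?_⟩
  have e := Z1_mul α (rfl : τ p.right = τ p.right) h1
  simp only [SemidirectProduct.mul_right, SemidirectProduct.inv_right, mul_one,
    mul_inv_cancel_left] at e h2
  rw [α.2 p.right, one_mul, ← h2] at e
  rw [e]
  simp only [SemidirectProduct.mul_left, SemidirectProduct.inv_left, SemidirectProduct.inv_right,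
    smul_mul', smul_act_inv, mul_inv_cancel_left]

/-- The homomorphism `ψ : (A ⋊ P) / N_α → G`, `(a, x) N_α ↦ τ x`. -/
def extProj (α : Z1 τ A) : Semi τ A ⧸ N α →* G :=
  QuotientGroup.lift (N α) ((τ : P →* G).comp SemidirectProduct.rightHom) (by
    rintro p ⟨hp, -⟩
    change τ p.right = 1
    rw [← hp, map_one])

/-- The homomorphism `σ : A → (A ⋊ P) / N_α`, `a ↦ (a, 1) N_α`. -/
def extIncl (α : Z1 τ A) : A →* Semi τ A ⧸ N α :=
  (QuotientGroup.mk' (N α)).comp SemidirectProduct.inl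

theorem extProj_mk (α : Z1 τ A) (p : Semi τ A) :
    extProj α (QuotientGroup.mk p) = τ p.right := rfl

theorem extIncl_mk (α : Z1 τ A) (a : A) :
    extIncl α a = QuotientGroup.mk (SemidirectProduct.inl a : Semi τ A) := rfl

theorem extIncl_injective (α : Z1 τ A) : Function.Injective (extIncl α) := by
  refine (injective_iff_map_eq_one _).2 fun a ha => ?_
  rw [extIncl_mk, QuotientGroup.eq_one_iff] at ha
  obtain ⟨_, h⟩ := ha
  exact h.trans (α.2 1)

theorem range_extIncl (α : Z1 τ A) : (extIncl α).range = (extProj α).ker := by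
  ext y
  constructor
  · rintro ⟨a, rfl⟩
    exact map_one τ
  · obtain ⟨p, rfl⟩ := QuotientGroup.mk_surjective y
    intro h
    have h : τ p.right = τ 1 := h.trans (map_one τ).symm
    refine ⟨p.left * α.1.1 ⟨(p.right, 1), h⟩, ?_⟩
    rw [extIncl_mk, QuotientGroup.eq]
    have h' : τ 1 = τ ((SemidirectProduct.inl (p.left * α.1.1 ⟨(p.right, 1), h⟩) : Semi τ A)⁻¹ *
        p).right := by simp [h]
    refine ⟨h', ?_⟩
    have e := Z1_comp α h h.symm
    rw [α.2] at e
    simp only [SemidirectProduct.mul_left, SemidirectProduct.inv_left,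
      SemidirectProduct.inv_right, SemidirectProduct.left_inl, SemidirectProduct.right_inl,
      SemidirectProduct.mul_right, inv_one, map_one, MulAut.one_apply, mul_inv, one_mul]
    rw [mul_right_comm, inv_mul_cancel, one_mul]
    exact inv_eq_of_mul_eq_one_right e

theorem continuous_extIncl [ContinuousSMul G A] (α : Z1 τ A) : Continuous (extIncl α) := by
  have : Continuous (fun a => (SemidirectProduct.inl a : Semi τ A)) :=
    (continuous_semi_iff τ A _).2 ⟨continuous_id, continuous_const⟩
  exact continuous_quot_mk.comp this

theorem continuous_extProj (α : Z1 τ A) : Continuous (extProj α) :=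
  Continuous.quotient_lift (τ.continuous_toFun.comp (continuous_right τ A)) _

theorem isEmbedding_extIncl [ContinuousSMul G A] (α : Z1 τ A)
    (hs : ∃ s : G → P, Continuous s ∧ ∀ g, τ (s g) = g) : IsEmbedding (extIncl α) := by
  obtain ⟨s, hs, hsτ⟩ := hs
  let r : Semi τ A → A := fun p => p.left * α.1.1 ⟨(p.right, s (τ p.right)), (hsτ _).symm⟩
  have hr : Continuous r := by
    have hR := continuous_right τ A
    refine (continuous_left τ A).mul (α.1.1.continuous.comp ?_)
    exact (hR.prodMk (hs.comp (τ.continuous_toFun.comp hR))).subtype_mk _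
  have hinv : ∀ p q : Semi τ A, (QuotientGroup.leftRel (N α)) p q → r p = r q := by
    intro p q h
    obtain ⟨hτ, h⟩ := left_mul_eq α (QuotientGroup.leftRel_apply.1 h)
    have hq : τ q.right = τ (s (τ q.right)) := (hsτ _).symm
    have e := Z1_comp α hτ hq
    have : ∀ g (hg : τ p.right = τ (s g)) (_ : g = τ q.right),
        α.1.1 ⟨(p.right, s g), hg⟩ = α.1.1 ⟨(p.right, s (τ q.right)), hτ.trans hq⟩ := by
      rintro g hg rfl; rfl
    simp only [r]
    rw [this _ _ hτ, ← e, ← mul_assoc, h]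
  let ρ : Semi τ A ⧸ N α → A := Quotient.lift r hinv
  have hρ : Continuous ρ := hr.quotient_lift hinv
  have h1 : τ 1 = τ (s (τ 1)) := (hsτ _).symm
  have hleft : Function.LeftInverse (fun y => ρ y * (α.1.1 ⟨(1, s (τ 1)), h1⟩)⁻¹) (extIncl α) :=
    fun a => mul_inv_cancel_right a _
  exact Function.LeftInverse.isEmbedding hleft (hρ.mul continuous_const) (continuous_extIncl α)

theorem extProj_section (α : Z1 τ A) (hs : ∃ s : G → P, Continuous s ∧ ∀ g, τ (s g) = g) :
    ∃ t : G → Semi τ A ⧸ N α, Continuous t ∧ ∀ g, extProj α (t g) = g := by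
  obtain ⟨s, hs, hsτ⟩ := hs
  have : Continuous (fun g => (SemidirectProduct.inr (s g) : Semi τ A)) :=
    (continuous_semi_iff τ A _).2 ⟨continuous_const, hs⟩
  exact ⟨fun g => QuotientGroup.mk (SemidirectProduct.inr (s g)), continuous_quot_mk.comp this, hsτ⟩

theorem isOpenMap_of_section {X Y : Type*} [Group X] [TopologicalSpace X] [IsTopologicalGroup X]
    [Group Y] [TopologicalSpace Y] (f : X →* Y)
    (hs : ∃ s : Y → X, Continuous s ∧ ∀ y, f (s y) = y) : IsOpenMap f := by
  obtain ⟨s, hs, hsf⟩ := hs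
  intro U hU
  rw [isOpen_iff_mem_nhds]
  rintro _ ⟨x, hx, rfl⟩
  have hc : Continuous fun y => s y * (s (f x))⁻¹ * x :=
    (hs.mul continuous_const).mul continuous_const
  refine Filter.mem_of_superset ((hU.preimage hc).mem_nhds (by simpa using hx)) fun y hy => ?_
  exact ⟨_, hy, by simp [hsf]⟩

/-- The extension `e_α : 1 → A → (A ⋊ P) / N_α → G → 1` as an element of `opext_s(G, A)`. -/
def extOf [ContinuousSMul G A] (hs : ∃ s : G → P, Continuous s ∧ ∀ g, τ (s g) = g)
    (α : Z1 τ A) : ProperExt G A where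
  E := Semi τ A ⧸ N α
  toExt :=
    { inl := extIncl α
      rightHom := extProj α
      inl_injective := extIncl_injective α
      range_inl_eq_ker_rightHom := range_extIncl α
      rightHom_surjective := fun g =>
        let ⟨t, _, ht⟩ := extProj_section α hs
        ⟨t g, ht g⟩ }
  isEmbedding_inl := isEmbedding_extIncl α hs
  continuous_rightHom := continuous_extProj α
  isOpenMap_rightHom := isOpenMap_of_section _ (extProj_section α hs)
  exists_section := extProj_section α hs
  inl_smul := by
    intro e a
    obtain ⟨p, rfl⟩ := QuotientGroup.mk_surjective e
    change QuotientGroup.mk _ = QuotientGroup.mk (p * SemidirectProduct.inl a * p⁻¹)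
    congr 1
    ext
    · change τ p.right • a = _
      rw [SemidirectProduct.mul_left, SemidirectProduct.inv_left, act_apply,
        SemidirectProduct.mul_right, SemidirectProduct.right_inl, mul_one, smul_act_inv,
        SemidirectProduct.mul_left, SemidirectProduct.left_inl, act_apply]
      rw [mul_right_comm, mul_inv_cancel, one_mul]
    · simp

end Semidirect

end HuCohomology

/-!
Every extension with a continuous section has a factor set, and for a fixed extension the factor
sets are exactly one class of continuous cocycles modulo continuous coboundaries: changing the
section `s` to `c · s` multiplies the factor set by `d₁ c`. Equivalent extensions have the same
factor sets, two extensions with a common factor set are equivalent, and every continuous cocycle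
`f` is a factor set of the twisted product `A ×_f G`. This yields the bijection
`Ψ : Opext_s(G, A) → H²(G, A)` (`opextEquivH2`).

For the second part, fix a continuous section `s` of `τ : P → G`. The section `g ↦ (1, s g) N_α` of
`e_α` has the factor set `f_α (g, h) = α (s g * s h, s (g * h))`, and `α ↦ f_α` is visibly a
homomorphism `Z¹(M, A) → Z²(G, A)`.
* Its composite with `Z² → H²` has kernel `range η`. If `α = η γ` then `f_α = d₁ (γ ∘ s)`; if
  `f_α = d₁ c` then `γ x = α (x, s (τ x)) * c (τ x)` is a crossed homomorphism with `η γ = α`.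
* It is surjective because `P` is projective: if `E` is an extension with factor set `f`, a lift
  `φ : P → E` of `τ` gives `α (x, y) = φ x * (φ y)⁻¹` in `Z¹(M, A)`, and then `f_α` is the factor
  set of `E` for the section `φ ∘ s`, hence cohomologous to `f`.
The first isomorphism theorem then gives `Φ`.
-/

namespace HuCohomology

open Topology

set_option linter.unusedSectionVars false

/-! ### Cocycle identities -/

section Cocycles

variable {G A : Type*} [Group G] [TopologicalSpace G] [IsTopologicalGroup G]
  [CommGroup A] [TopologicalSpace A] [IsTopologicalGroup A]
  [MulDistribMulAction G A] [ContinuousSMul G A]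

theorem d₁_apply (c : C(G, A)) (g h : G) :
    d₁ G A c (g, h) = g • c h * (c (g * h))⁻¹ * c g := rfl

theorem d₁_apply_mul (c : C(G, A)) (g h : G) :
    d₁ G A c (g, h) * c (g * h) = g • c h * c g := by
  rw [d₁_apply, mul_right_comm, inv_mul_cancel_right]

theorem mem_Z2_iff (f : C(G × G, A)) :
    f ∈ Z2 G A ↔ ∀ g h k, g • f (h, k) * f (g, h * k) = f (g * h, k) * f (g, h) := by
  rw [MonoidHom.mem_ker, ContinuousMap.ext_iff]
  have key : ∀ g h k, d₂ G A f (g, h, k) = (1 : C(G × G × G, A)) (g, h, k) ↔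
      g • f (h, k) * f (g, h * k) = f (g * h, k) * f (g, h) := by
    intro g h k
    change g • f (h, k) * (f (g * h, k))⁻¹ * f (g, h * k) * (f (g, h))⁻¹ = 1 ↔ _
    rw [mul_right_comm (g • f (h, k)), mul_inv_eq_one, mul_inv_eq_iff_eq_mul,
      mul_comm (f (g, h))]
  exact ⟨fun H g h k => (key g h k).1 (H _), fun H p => (key _ _ _).2 (H _ _ _)⟩

theorem Z2_one_left (f : Z2 G A) (g : G) : f.1 (1, g) = f.1 (1, 1) := by
  have := (mem_Z2_iff f.1).1 f.2 1 1 g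
  simpa using this

theorem Z2_one_right (f : Z2 G A) (g : G) : f.1 (g, 1) = g • f.1 (1, 1) := by
  have := (mem_Z2_iff f.1).1 f.2 g 1 1
  simpa using this.symm

theorem H2_mk_eq_iff (f f' : Z2 G A) :
    (QuotientGroup.mk f : H2 G A) = QuotientGroup.mk f' ↔ ∃ c, f'.1 = f.1 * d₁ G A c := by
  rw [QuotientGroup.eq, Subgroup.mem_subgroupOf]
  change (∃ c, d₁ G A c = (f.1)⁻¹ * f'.1) ↔ _
  simp only [eq_inv_mul_iff_mul_eq]
  exact exists_congr fun c => eq_comm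

end Cocycles

/-! ### Factor sets of extensions -/

section FactorSets

variable {G A : Type u} [Group G] [TopologicalSpace G]
  [CommGroup A] [TopologicalSpace A] [MulDistribMulAction G A]

namespace ProperExt

theorem rightHom_inl (e : ProperExt G A) (a : A) : e.toExt.rightHom (e.toExt.inl a) = 1 := by
  have : e.toExt.inl a ∈ e.toExt.rightHom.ker := by
    rw [← e.toExt.range_inl_eq_ker_rightHom]
    exact ⟨a, rfl⟩
  exact this

theorem mul_inl (e : ProperExt G A) (x : e.E) (a : A) :
    x * e.toExt.inl a = e.toExt.inl (e.toExt.rightHom x • a) * x := by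
  rw [e.inl_smul, inv_mul_cancel_right]

/-- A continuous map into the kernel of `E → G` factors through a continuous map into `A`. -/
theorem exists_continuousMap_inl (e : ProperExt G A) {X : Type*} [TopologicalSpace X]
    {u : X → e.E} (hu : Continuous u) (h : ∀ x, e.toExt.rightHom (u x) = 1) :
    ∃ a : C(X, A), ∀ x, e.toExt.inl (a x) = u x := by
  have hmem : ∀ x, ∃ a, e.toExt.inl a = u x := fun x => by
    have : u x ∈ e.toExt.rightHom.ker := h x
    rwa [← e.toExt.range_inl_eq_ker_rightHom] at this
  choose a ha using hmem
  refine ⟨⟨a, ?_⟩, ha⟩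
  rw [e.isEmbedding_inl.continuous_iff, show e.toExt.inl ∘ a = u from funext ha]
  exact hu

theorem IsFactorSet.of_equivalent {e e' : ProperExt G A} (h : e.Equivalent e')
    {f : C(G × G, A)} (hf : e.IsFactorSet f) : e'.IsFactorSet f := by
  obtain ⟨θ, hA, hG⟩ := h
  obtain ⟨s, hs, hsG, hsf⟩ := hf
  refine ⟨fun g => θ (s g), θ.continuous_toFun.comp hs, fun g => by rw [hG, hsG], fun g h => ?_⟩
  rw [← map_mul, hsf, map_mul, hA]

/-- Two extensions with a common factor set are equivalent, through
`inl a * s g ↦ inl a * s' g`. -/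
theorem IsFactorSet.equivalent {e e' : ProperExt G A} {f : C(G × G, A)}
    (hf : e.IsFactorSet f) (hf' : e'.IsFactorSet f) : e.Equivalent e' := by
  obtain ⟨s, hs, hsG, hsf⟩ := hf
  obtain ⟨s', hs', hsG', hsf'⟩ := hf'
  obtain ⟨a, ha⟩ := e.exists_continuousMap_inl
    (u := fun x => x * (s (e.toExt.rightHom x))⁻¹)
    (continuous_id.mul (hs.comp e.continuous_rightHom).inv)
    (fun x => by rw [map_mul, map_inv, hsG, mul_inv_cancel])
  have hdec : ∀ x, x = e.toExt.inl (a x) * s (e.toExt.rightHom x) := fun x => by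
    rw [ha, inv_mul_cancel_right]
  have huniq : ∀ b x, x = e.toExt.inl b * s (e.toExt.rightHom x) → a x = b := fun b x hx =>
    e.toExt.inl_injective (by rw [ha, mul_inv_eq_iff_eq_mul]; exact hx)
  -- The section need not send `1` to `1`, so the unit of `E` is `inl (f (1, 1))⁻¹ * s 1`.
  have hone : ∀ {d : ProperExt G A} {t : G → d.E}, (∀ g h, t g * t h =
      d.toExt.inl (f (g, h)) * t (g * h)) → t 1 = d.toExt.inl (f (1, 1)) := by
    intro d t ht
    have := ht 1 1
    rw [mul_one] at this
    exact mul_right_cancel this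
  have hmul : ∀ {d : ProperExt G A} {t : G → d.E}, (∀ g, d.toExt.rightHom (t g) = g) →
      (∀ g h, t g * t h = d.toExt.inl (f (g, h)) * t (g * h)) → ∀ b c g h,
      d.toExt.inl b * t g * (d.toExt.inl c * t h) =
        d.toExt.inl (b * g • c * f (g, h)) * t (g * h) := by
    intro d t ht htf b c g h
    rw [mul_assoc, ← mul_assoc (t g), mul_inl, ht, mul_assoc, htf]
    simp only [map_mul, mul_assoc]
  have hθone : e'.toExt.inl (a 1) * s' (e.toExt.rightHom 1) = 1 := by
    rw [huniq (f (1, 1))⁻¹ 1 (by rw [map_one, hone hsf, map_inv, inv_mul_cancel]), map_one,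
      hone hsf', map_inv, inv_mul_cancel]
  refine ⟨⟨⟨⟨fun x => e'.toExt.inl (a x) * s' (e.toExt.rightHom x), hθone⟩, fun x y => ?_⟩,
    ?_⟩, fun b => ?_, fun x => ?_⟩
  · change e'.toExt.inl (a (x * y)) * s' (e.toExt.rightHom (x * y)) =
      e'.toExt.inl (a x) * s' (e.toExt.rightHom x) * (e'.toExt.inl (a y) * s' (e.toExt.rightHom y))
    rw [hmul hsG' hsf', huniq (a x * e.toExt.rightHom x • a y *
      f (e.toExt.rightHom x, e.toExt.rightHom y)) (x * y), map_mul e.toExt.rightHom]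
    rw [map_mul e.toExt.rightHom, ← hmul hsG hsf, ← hdec, ← hdec]
  · exact (e'.isEmbedding_inl.continuous.comp a.continuous).mul (hs'.comp e.continuous_rightHom)
  · change e'.toExt.inl (a (e.toExt.inl b)) * s' (e.toExt.rightHom (e.toExt.inl b)) = _
    rw [huniq (b * (f (1, 1))⁻¹) (e.toExt.inl b) (by
      rw [rightHom_inl, hone hsf, ← map_mul, inv_mul_cancel_right]), rightHom_inl, hone hsf',
      ← map_mul, inv_mul_cancel_right]
  · change e'.toExt.rightHom (e'.toExt.inl (a x) * s' (e.toExt.rightHom x)) = _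
    rw [map_mul, rightHom_inl, one_mul, hsG']

variable [IsTopologicalGroup G] [IsTopologicalGroup A] [ContinuousSMul G A]

theorem IsFactorSet.mem_Z2 {e : ProperExt G A} {f : C(G × G, A)} (hf : e.IsFactorSet f) :
    f ∈ Z2 G A := by
  obtain ⟨s, -, hsG, hsf⟩ := hf
  refine (mem_Z2_iff f).2 fun g h k => e.toExt.inl_injective ?_
  apply mul_right_cancel (b := s (g * h * k))
  have h1 : s g * (s h * s k) =
      e.toExt.inl (g • f (h, k) * f (g, h * k)) * s (g * h * k) := by
    rw [hsf h k, ← mul_assoc, mul_inl, hsG, mul_assoc, hsf g (h * k), ← mul_assoc, map_mul,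
      mul_assoc g]
  have h2 : s g * s h * s k = e.toExt.inl (f (g * h, k) * f (g, h)) * s (g * h * k) := by
    rw [hsf g h, mul_assoc, hsf (g * h) k, ← mul_assoc, ← map_mul, mul_comm (f (g, h))]
  rw [← h1, ← h2, mul_assoc]

theorem isFactorSet_of_section (e : ProperExt G A) {s : G → e.E} (hs : Continuous s)
    (hsG : ∀ g, e.toExt.rightHom (s g) = g) :
    ∃ f : Z2 G A, ∀ g h, s g * s h = e.toExt.inl (f.1 (g, h)) * s (g * h) := by
  obtain ⟨f, hf⟩ := e.exists_continuousMap_inl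
    (u := fun p : G × G => s p.1 * s p.2 * (s (p.1 * p.2))⁻¹)
    (by fun_prop) (fun p => by simp [hsG])
  have hsf : ∀ g h, s g * s h = e.toExt.inl (f (g, h)) * s (g * h) := fun g h => by
    rw [hf, inv_mul_cancel_right]
  exact ⟨⟨f, IsFactorSet.mem_Z2 ⟨s, hs, hsG, hsf⟩⟩, hsf⟩

theorem exists_isFactorSet (e : ProperExt G A) : ∃ f : Z2 G A, e.IsFactorSet f.1 := by
  obtain ⟨s, hs, hsG⟩ := e.exists_section
  obtain ⟨f, hf⟩ := e.isFactorSet_of_section hs hsG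
  exact ⟨f, s, hs, hsG, hf⟩

/-- Replacing the section `s` by `c · s` changes the factor set by `d₁ c`. -/
theorem IsFactorSet.mul_d₁ {e : ProperExt G A} {f : C(G × G, A)} (hf : e.IsFactorSet f)
    (c : C(G, A)) : e.IsFactorSet (f * d₁ G A c) := by
  obtain ⟨s, hs, hsG, hsf⟩ := hf
  refine ⟨fun g => e.toExt.inl (c g) * s g,
    (e.isEmbedding_inl.continuous.comp c.continuous).mul hs,
    fun g => by rw [map_mul, rightHom_inl, one_mul, hsG], fun g h => ?_⟩
  rw [mul_assoc, ← mul_assoc (s g), mul_inl, hsG, mul_assoc, hsf]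
  simp only [← mul_assoc, ← map_mul]
  rw [ContinuousMap.mul_apply, mul_assoc (f (g, h)), d₁_apply_mul]
  congr 2
  ac_rfl

theorem IsFactorSet.exists_eq_mul_d₁ {e : ProperExt G A} {f f' : C(G × G, A)}
    (hf : e.IsFactorSet f) (hf' : e.IsFactorSet f') : ∃ c, f' = f * d₁ G A c := by
  obtain ⟨s, hs, hsG, hsf⟩ := hf
  obtain ⟨s', hs', hsG', hsf'⟩ := hf'
  obtain ⟨c, hc⟩ := e.exists_continuousMap_inl (u := fun g => s' g * (s g)⁻¹)
    (hs'.mul hs.inv) (fun g => by rw [map_mul, map_inv, hsG, hsG', mul_inv_cancel])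
  have hc' : ∀ g, s' g = e.toExt.inl (c g) * s g := fun g => by
    rw [hc, inv_mul_cancel_right]
  refine ⟨c, ContinuousMap.ext fun ⟨g, h⟩ => ?_⟩
  have key := hsf' g h
  rw [hc', hc', hc', mul_assoc, ← mul_assoc (s g), mul_inl, hsG, mul_assoc, hsf] at key
  simp only [← mul_assoc, ← map_mul] at key
  have key := e.toExt.inl_injective (mul_right_cancel key)
  rw [← mul_left_inj (c (g * h)), ← key, ContinuousMap.mul_apply, mul_assoc (f (g, h)),
    d₁_apply_mul]
  ac_rfl

end ProperExt

end FactorSets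

/-! ### The extension attached to a continuous cocycle -/

section TwistedProducts

variable {G A : Type u} [Group G] [TopologicalSpace G] [IsTopologicalGroup G]
  [CommGroup A] [TopologicalSpace A] [IsTopologicalGroup A]
  [MulDistribMulAction G A] [ContinuousSMul G A]

/-- The twisted product `A ×_f G`: the space `A × G` with the multiplication
`(a, g) (b, h) = (a * g • b * f (g, h), g * h)`. The cocycle `f` is not assumed normalized, so the
unit is `((f (1, 1))⁻¹, 1)`. -/
@[ext]
structure TwistedProd (f : Z2 G A) where
  left : A
  right : G

namespace TwistedProd

variable (f : Z2 G A)

instance : TopologicalSpace (TwistedProd f) :=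
  TopologicalSpace.induced (fun x => (x.left, x.right)) inferInstance

theorem continuous_iff {X : Type*} [TopologicalSpace X] {u : X → TwistedProd f} :
    Continuous u ↔ Continuous (fun x => (u x).left) ∧ Continuous (fun x => (u x).right) := by
  rw [continuous_induced_rng, continuous_prodMk.symm]
  rfl

theorem continuous_left : Continuous (left : TwistedProd f → A) :=
  ((continuous_iff f).1 continuous_id).1

theorem continuous_right : Continuous (right : TwistedProd f → G) :=
  ((continuous_iff f).1 continuous_id).2

instance : Mul (TwistedProd f) :=
  ⟨fun x y => ⟨x.left * x.right • y.left * f.1 (x.right, y.right), x.right * y.right⟩⟩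

instance : One (TwistedProd f) := ⟨⟨(f.1 (1, 1))⁻¹, 1⟩⟩

instance : Inv (TwistedProd f) :=
  ⟨fun x => ⟨(f.1 (1, 1) * f.1 (x.right⁻¹, x.right) * x.right⁻¹ • x.left)⁻¹, x.right⁻¹⟩⟩

theorem mk_mul_mk (a b : A) (g h : G) :
    (⟨a, g⟩ * ⟨b, h⟩ : TwistedProd f) = ⟨a * g • b * f.1 (g, h), g * h⟩ := rfl

theorem one_def : (1 : TwistedProd f) = ⟨(f.1 (1, 1))⁻¹, 1⟩ := rfl

theorem inv_mk (a : A) (g : G) :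
    (⟨a, g⟩⁻¹ : TwistedProd f) = ⟨(f.1 (1, 1) * f.1 (g⁻¹, g) * g⁻¹ • a)⁻¹, g⁻¹⟩ := rfl

instance : Group (TwistedProd f) :=
  Group.ofLeftAxioms
    (by
      rintro ⟨a, g⟩ ⟨b, h⟩ ⟨c, k⟩
      simp only [mk_mul_mk, mul_assoc g h k, mk.injEq, and_true]
      have e := (mem_Z2_iff f.1).1 f.2 g h k
      calc _ = a * g • b * (g * h) • c * (f.1 (g * h, k) * f.1 (g, h)) := by ac_rfl
        _ = _ := by rw [← e]; simp only [smul_mul', mul_smul, mul_assoc])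
    (by
      rintro ⟨a, g⟩
      rw [one_def, mk_mul_mk, one_smul, one_mul, Z2_one_left f g, mul_right_comm, inv_mul_cancel,
        one_mul])
    (by
      rintro ⟨a, g⟩
      rw [inv_mk, mk_mul_mk, inv_mul_cancel, one_def]
      congr 1
      rw [mul_assoc, inv_mul_eq_iff_eq_mul, eq_mul_inv_iff_mul_eq]
      ac_rfl)

instance : IsTopologicalGroup (TwistedProd f) where
  continuous_mul := by
    have hl := continuous_left f
    have hr := continuous_right f
    refine (continuous_iff f).2 ⟨?_, ?_⟩
    · change Continuous fun p : TwistedProd f × TwistedProd f =>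
        p.1.left * p.1.right • p.2.left * f.1 (p.1.right, p.2.right)
      fun_prop
    · change Continuous fun p : TwistedProd f × TwistedProd f => p.1.right * p.2.right
      fun_prop
  continuous_inv := by
    have hl := continuous_left f
    have hr := continuous_right f
    refine (continuous_iff f).2 ⟨?_, hr.inv⟩
    change Continuous fun x : TwistedProd f =>
      (f.1 (1, 1) * f.1 (x.right⁻¹, x.right) * x.right⁻¹ • x.left)⁻¹
    fun_prop

/-- The embedding `a ↦ (a * (f (1, 1))⁻¹, 1)`. -/
def inl : A →* TwistedProd f where
  toFun a := ⟨a * (f.1 (1, 1))⁻¹, 1⟩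
  map_one' := by rw [one_mul, one_def]
  map_mul' a b := by
    rw [mk_mul_mk, one_smul, one_mul, ← mul_assoc, inv_mul_cancel_right, mul_right_comm]

/-- The projection to `G`. -/
def rightHom : TwistedProd f →* G where
  toFun := right
  map_one' := rfl
  map_mul' _ _ := rfl

theorem inl_apply (a : A) : inl f a = ⟨a * (f.1 (1, 1))⁻¹, 1⟩ := rfl

theorem inl_mul_mk (a b : A) (g : G) : inl f a * ⟨b, g⟩ = ⟨a * b, g⟩ := by
  rw [inl_apply, mk_mul_mk, one_smul, one_mul, Z2_one_left f g, mul_right_comm,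
    inv_mul_cancel_right]

theorem mk_mul_inl (a b : A) (g : G) : (⟨b, g⟩ : TwistedProd f) * inl f a = ⟨g • a * b, g⟩ := by
  rw [inl_apply, mk_mul_mk, mul_one, Z2_one_right f g, smul_mul', smul_inv', ← mul_assoc,
    inv_mul_cancel_right, mul_comm]

theorem continuous_mk_one : Continuous fun g : G => (⟨1, g⟩ : TwistedProd f) :=
  (continuous_iff f).2 ⟨continuous_const, continuous_id⟩

theorem exists_section :
    ∃ s : G → TwistedProd f, Continuous s ∧ ∀ g, rightHom f (s g) = g :=
  ⟨_, continuous_mk_one f, fun _ => rfl⟩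

/-- The twisted product as an extension of `G` by `A`. -/
def properExt : ProperExt G A where
  E := TwistedProd f
  toExt :=
    { inl := inl f
      rightHom := rightHom f
      inl_injective := fun _ _ h => mul_right_cancel (congrArg left h)
      range_inl_eq_ker_rightHom := by
        ext ⟨b, g⟩
        constructor
        · rintro ⟨a, h⟩
          exact (congrArg right h).symm
        · intro h
          exact ⟨b * f.1 (1, 1), TwistedProd.ext (mul_inv_cancel_right b _) h.symm⟩
      rightHom_surjective := fun g => ⟨⟨1, g⟩, rfl⟩ }
  isEmbedding_inl :=
    Function.LeftInverse.isEmbedding (f := fun x : TwistedProd f => x.left * f.1 (1, 1))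
      (fun a => inv_mul_cancel_right a _) ((continuous_left f).mul continuous_const)
      ((continuous_iff f).2 ⟨continuous_id.mul continuous_const, continuous_const⟩)
  continuous_rightHom := continuous_right f
  isOpenMap_rightHom := isOpenMap_of_section _ (exists_section f)
  exists_section := exists_section f
  inl_smul := by
    rintro ⟨b, g⟩ a
    exact eq_mul_inv_of_mul_eq ((inl_mul_mk f (g • a) b g).trans (mk_mul_inl f a b g).symm)

theorem isFactorSet_properExt : (properExt f).IsFactorSet f.1 := by
  refine ⟨_, continuous_mk_one f, fun _ => rfl, fun g h => ?_⟩
  refine Eq.trans ?_ (inl_mul_mk f (f.1 (g, h)) 1 (g * h)).symm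
  change (⟨1, g⟩ * ⟨1, h⟩ : TwistedProd f) = _
  rw [mk_mul_mk, smul_one, one_mul, one_mul, mul_one]

end TwistedProd

end TwistedProducts

/-! ### Extensions are classified by their factor sets -/

section Classification

variable {G A : Type u} [Group G] [TopologicalSpace G] [IsTopologicalGroup G]
  [CommGroup A] [TopologicalSpace A] [IsTopologicalGroup A]
  [MulDistribMulAction G A] [ContinuousSMul G A]

namespace ProperExt

/-- The class in `H²(G, A)` of the factor sets of an extension. -/
noncomputable def h2Class (e : ProperExt G A) : H2 G A :=
  QuotientGroup.mk e.exists_isFactorSet.choose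

theorem h2Class_eq_mk_iff (e : ProperExt G A) (f : Z2 G A) :
    e.h2Class = QuotientGroup.mk f ↔ e.IsFactorSet f.1 := by
  have h0 := e.exists_isFactorSet.choose_spec
  rw [h2Class, H2_mk_eq_iff]
  constructor
  · rintro ⟨c, hc⟩
    rw [hc]
    exact h0.mul_d₁ c
  · exact h0.exists_eq_mul_d₁

theorem h2Class_eq_iff (e e' : ProperExt G A) : e.h2Class = e'.h2Class ↔ e.Equivalent e' := by
  obtain ⟨f', hf'⟩ := e'.exists_isFactorSet
  rw [(h2Class_eq_mk_iff e' f').2 hf', h2Class_eq_mk_iff]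
  exact ⟨fun h => h.equivalent hf', fun h => hf'.of_equivalent h.symm⟩

end ProperExt

variable (G A) in
/-- The bijection `Opext_s(G, A) → H²(G, A)` given by factor sets. -/
noncomputable def opextEquivH2 : Opext G A ≃ H2 G A :=
  Equiv.ofBijective
    (Quotient.lift ProperExt.h2Class fun e e' h => (ProperExt.h2Class_eq_iff e e').2 h)
    ⟨by
      rintro ⟨e⟩ ⟨e'⟩ h
      exact Quotient.sound ((ProperExt.h2Class_eq_iff e e').1 h),
    by
      intro y
      obtain ⟨f, rfl⟩ := QuotientGroup.mk_surjective y
      exact ⟨Quotient.mk _ (TwistedProd.properExt f),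
        (ProperExt.h2Class_eq_mk_iff _ f).2 (TwistedProd.isFactorSet_properExt f)⟩⟩

theorem opextEquivH2_mk_eq_iff (e : ProperExt G A) (f : Z2 G A) :
    opextEquivH2 G A (Quotient.mk _ e) = QuotientGroup.mk f ↔ e.IsFactorSet f.1 :=
  e.h2Class_eq_mk_iff f

end Classification

/-! ### The cocycle of a crossed homomorphism on the simplicial kernel -/

section KernelCocycles

variable {G A P : Type u} [Group G] [TopologicalSpace G] [IsTopologicalGroup G]
  [CommGroup A] [TopologicalSpace A] [IsTopologicalGroup A]
  [MulDistribMulAction G A] [ContinuousSMul G A]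
  [Group P] [TopologicalSpace P] [IsTopologicalGroup P]
  {τ : P →ₜ* G} {s : G → P} (hs : Continuous s) (hsτ : ∀ g, τ (s g) = g)

/-- The continuous map `(g, h) ↦ (s g * s h, s (g * h))` from `G × G` to `M`. -/
def sectionPair : C(G × G, stdKernel τ) where
  toFun p := ⟨(s p.1 * s p.2, s (p.1 * p.2)), by
    change τ (s p.1 * s p.2) = τ (s (p.1 * p.2))
    rw [map_mul, hsτ, hsτ, hsτ]⟩
  continuous_toFun := by
    refine Continuous.subtype_mk ?_ _
    fun_prop

/-- The converse of `left_mul_eq`. -/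
theorem inv_mul_mem_N (α : Z1 τ A) {p q : Semi τ A} (h : τ p.right = τ q.right)
    (e : p.left * α.1.1 ⟨(p.right, q.right), h⟩ = q.left) : p⁻¹ * q ∈ N α := by
  have h1 : τ 1 = τ (p⁻¹ * q).right := by simp [h]
  refine ⟨h1, ?_⟩
  have e1 := Z1_mul α (rfl : τ p.right = τ p.right) h1
  simp only [SemidirectProduct.mul_right, SemidirectProduct.inv_right, mul_one,
    mul_inv_cancel_left] at e1 ⊢
  rw [α.2 p.right, one_mul] at e1
  apply MulAction.injective (τ p.right)
  change τ p.right • (p⁻¹ * q).left = τ p.right • _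
  rw [← e1, ← inv_mul_eq_iff_eq_mul.2 e.symm]
  simp only [SemidirectProduct.mul_left, SemidirectProduct.inv_left, SemidirectProduct.inv_right,
    smul_mul', smul_act_inv]

/-- The cocycle `f_α (g, h) = α (s g * s h, s (g * h))` is the factor set of `e_α` for the section
`g ↦ (1, s g) N_α`. -/
theorem isFactorSet_extOf (hs' : ∃ s : G → P, Continuous s ∧ ∀ g, τ (s g) = g) (α : Z1 τ A) :
    (extOf hs' α).IsFactorSet (α.1.1.comp (sectionPair hs hsτ)) := by
  have hc : Continuous fun g => (SemidirectProduct.inr (s g) : Semi τ A) :=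
    (continuous_semi_iff τ A _).2 ⟨continuous_const, hs⟩
  refine ⟨fun g => QuotientGroup.mk (SemidirectProduct.inr (s g)), continuous_quot_mk.comp hc,
    hsτ, fun g h => ?_⟩
  refine QuotientGroup.eq.2 (inv_mul_mem_N α (p := SemidirectProduct.inr (s g) *
    SemidirectProduct.inr (s h)) (q := SemidirectProduct.inl _ * SemidirectProduct.inr (s (g * h)))
    ?_ ?_)
  · simp [hsτ]
  · simp only [SemidirectProduct.mul_left, SemidirectProduct.left_inr, SemidirectProduct.left_inl,
      map_one, mul_one, one_mul, SemidirectProduct.mul_right, SemidirectProduct.right_inr,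
      SemidirectProduct.right_inl]
    rfl

variable (A) in
/-- The homomorphism `Z¹(M, A) → Z²(G, A)` sending `α` to the cocycle
`f_α (g, h) = α (s g * s h, s (g * h))`. -/
def kernelCocycle : Z1 τ A →* Z2 G A where
  toFun α := ⟨α.1.1.comp (sectionPair hs hsτ),
    (isFactorSet_extOf hs hsτ ⟨s, hs, hsτ⟩ α).mem_Z2⟩
  map_one' := rfl
  map_mul' _ _ := rfl

variable (A) in
/-- The homomorphism `Z¹(M, A) → H²(G, A)` sending `α` to the class of `f_α`. -/
def kernelClass : Z1 τ A →* H2 G A :=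
  (QuotientGroup.mk' _).comp (kernelCocycle A hs hsτ)

theorem kernelClass_eq_one_iff (α : Z1 τ A) :
    kernelClass A hs hsτ α = 1 ↔
      ∃ c, ∀ g h, (kernelCocycle A hs hsτ α).1 (g, h) = d₁ G A c (g, h) := by
  change (QuotientGroup.mk _ : H2 G A) = 1 ↔ _
  rw [QuotientGroup.eq_one_iff, Subgroup.mem_subgroupOf]
  change (∃ c, d₁ G A c = _) ↔ _
  exact exists_congr fun c => ⟨fun h g k => by rw [h],
    fun h => ContinuousMap.ext fun p => (h p.1 p.2).symm⟩

theorem η_apply (γ : Der τ A) {x y : P} (h : τ x = τ y) :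
    (η τ A γ).1.1 ⟨(x, y), h⟩ = γ.1 x * (γ.1 y)⁻¹ := rfl

theorem kernelClass_η (γ : Der τ A) : kernelClass A hs hsτ (η τ A γ) = 1 := by
  refine (kernelClass_eq_one_iff hs hsτ _).2 ⟨γ.1.comp ⟨s, hs⟩, fun g h => ?_⟩
  change γ.1 (s g * s h) * (γ.1 (s (g * h)))⁻¹ = g • γ.1 (s h) * (γ.1 (s (g * h)))⁻¹ * γ.1 (s g)
  rw [γ.2, hsτ]
  ac_rfl

/-- If `f_α = d₁ c`, then `γ x = α (x, s (τ x)) * c (τ x)` is a crossed homomorphism with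
`η γ = α`. -/
theorem exists_η_eq (α : Z1 τ A) (h : kernelClass A hs hsτ α = 1) : ∃ γ, η τ A γ = α := by
  obtain ⟨c, hc⟩ := (kernelClass_eq_one_iff hs hsτ α).1 h
  have hx : ∀ x, τ x = τ (s (τ x)) := fun x => (hsτ _).symm
  have hτc : Continuous τ := τ.continuous_toFun
  have hcont : Continuous fun x => α.1.1 ⟨(x, s (τ x)), hx x⟩ * c (τ x) :=
    (α.1.1.continuous.comp ((continuous_id.prodMk (hs.comp hτc)).subtype_mk hx)).mul
      (c.continuous.comp hτc)
  refine ⟨⟨⟨_, hcont⟩, fun x y => ?_⟩, ?_⟩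
  · change α.1.1 ⟨(x * y, s (τ (x * y))), hx (x * y)⟩ * c (τ (x * y)) =
      α.1.1 ⟨(x, s (τ x)), hx x⟩ * c (τ x) * τ x • (α.1.1 ⟨(y, s (τ y)), hx y⟩ * c (τ y))
    have hm : τ (x * y) = τ (s (τ x) * s (τ y)) := by rw [map_mul, map_mul, hsτ, hsτ]
    have e := Z1_comp α hm (hm.symm.trans (hx (x * y)))
    have hf : α.1.1 ⟨(s (τ x) * s (τ y), s (τ (x * y))), hm.symm.trans (hx (x * y))⟩ *
        c (τ (x * y)) = τ x • c (τ y) * c (τ x) := by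
      have e' := d₁_apply_mul c (τ x) (τ y)
      rw [← hc, ← map_mul τ x y] at e'
      rw [← e']
      refine congrArg (fun m => α.1.1 m * _) (Subtype.ext (Prod.ext rfl ?_))
      change s (τ (x * y)) = s (τ x * τ y)
      rw [map_mul]
    rw [← e, mul_assoc, hf, Z1_mul α (hx x) (hx y), smul_mul']
    ac_rfl
  · refine Subtype.ext (Subtype.ext (ContinuousMap.ext ?_))
    rintro ⟨⟨x, y⟩, hxy⟩
    replace hxy : τ x = τ y := hxy
    refine (η_apply _ hxy).trans ?_
    change α.1.1 ⟨(x, s (τ x)), hx x⟩ * c (τ x) * (α.1.1 ⟨(y, s (τ y)), hx y⟩ * c (τ y))⁻¹ = _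
    -- The proof component of the point of `M` depends on `τ x`, so `τ x = τ y` is substituted
    -- through a free variable.
    have hs' : ∀ g (hg : τ x = τ (s g)), g = τ y →
        α.1.1 ⟨(x, s g), hg⟩ = α.1.1 ⟨(x, s (τ y)), hxy.trans (hx y)⟩ := by
      rintro g hg rfl; rfl
    rw [hs' _ (hx x) hxy, ← Z1_comp α hxy (hx y), hxy, ← div_eq_mul_inv, mul_div_mul_right_eq_div,
      mul_div_cancel_right]

theorem ker_kernelClass : (kernelClass A hs hsτ).ker = (η τ A).range := by
  ext α
  refine ⟨exists_η_eq hs hsτ α, ?_⟩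
  rintro ⟨γ, rfl⟩
  exact kernelClass_η hs hsτ γ

/-- A lift `φ` of `τ` to an extension gives the element `(x, y) ↦ φ x * (φ y)⁻¹` of
`Z¹(M, A)`. -/
theorem exists_Z1_of_lift (e : ProperExt G A) (φ : P →ₜ* e.E)
    (hφ : ∀ x, e.toExt.rightHom (φ x) = τ x) :
    ∃ α : Z1 τ A, ∀ x y (h : τ x = τ y),
      e.toExt.inl (α.1.1 ⟨(x, y), h⟩) = φ x * (φ y)⁻¹ := by
  have hφc : Continuous φ := φ.continuous_toFun
  obtain ⟨a, ha⟩ := e.exists_continuousMap_inl (X := stdKernel τ)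
    (u := fun m => φ m.1.1 * (φ m.1.2)⁻¹) (by fun_prop) (fun m => by
      rw [map_mul, map_inv, hφ, hφ, mul_inv_eq_one]
      exact m.2)
  refine ⟨⟨⟨a, fun m n => e.toExt.inl_injective ?_⟩, fun x => e.toExt.inl_injective ?_⟩,
    fun x y h => ha ⟨(x, y), h⟩⟩
  · change _ = e.toExt.inl (a m * τ m.1.1 • a n)
    have h1 : φ (m * n).1.1 = φ m.1.1 * φ n.1.1 := map_mul φ _ _
    have h2 : φ (m * n).1.2 = φ m.1.2 * φ n.1.2 := map_mul φ _ _
    rw [mul_comm (a m), map_mul e.toExt.inl, ← hφ, e.inl_smul, ha, ha, ha, h1, h2]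
    group
  · change e.toExt.inl (a ⟨(x, x), rfl⟩) = _
    rw [ha, map_one]
    exact mul_inv_cancel (φ x)

theorem kernelClass_surjective (hP : IsProjectiveGroup P) :
    Function.Surjective (kernelClass A hs hsτ) := by
  intro y
  obtain ⟨f, rfl⟩ := QuotientGroup.mk_surjective y
  let e := TwistedProd.properExt f
  obtain ⟨φ, hφ⟩ := hP e.E G ⟨e.toExt.rightHom, e.continuous_rightHom⟩
    e.toExt.rightHom_surjective e.exists_section τ
  replace hφ : ∀ x, e.toExt.rightHom (φ x) = τ x := hφ
  obtain ⟨α, hα⟩ := exists_Z1_of_lift e φ hφ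
  have hfs : e.IsFactorSet (kernelCocycle A hs hsτ α).1 := by
    refine ⟨fun g => φ (s g), φ.continuous_toFun.comp hs, fun g => by rw [hφ, hsτ], fun g h => ?_⟩
    have := hα (s g * s h) (s (g * h)) (by rw [map_mul, hsτ, hsτ, hsτ])
    rw [← map_mul, ← mul_inv_eq_iff_eq_mul]
    exact this.symm
  refine ⟨α, (e.h2Class_eq_mk_iff _).2 hfs |>.symm.trans ?_⟩
  exact (e.h2Class_eq_mk_iff f).2 (TwistedProd.isFactorSet_properExt f)

end KernelCocycles

end HuCohomology

theorem theorem2p1 {G A P : Type u}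
    [Group G] [TopologicalSpace G] [IsTopologicalGroup G]
    [CommGroup A] [TopologicalSpace A] [IsTopologicalGroup A]
    [MulDistribMulAction G A] [ContinuousSMul G A]
    [Group P] [TopologicalSpace P] [IsTopologicalGroup P]
    (τ : P →ₜ* G)
    (hτ : HuCohomology.IsProjectiveSimplicialKernel
      (HuCohomology.proj₀ τ) (HuCohomology.proj₁ τ) τ) :
    ∃ Ψ : HuCohomology.Opext G A ≃ HuCohomology.H2 G A,
      (∀ (e : HuCohomology.ProperExt G A) (f : HuCohomology.Z2 G A),
        Ψ (Quotient.mk _ e) = QuotientGroup.mk f ↔ e.IsFactorSet f) ∧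
      ∃ Φ : (HuCohomology.Z1 τ A ⧸ (HuCohomology.η τ A).range) ≃* HuCohomology.H2 G A,
        ∀ α : HuCohomology.Z1 τ A,
          Φ (QuotientGroup.mk α) =
            Ψ (Quotient.mk _ (HuCohomology.extOf hτ.exists_section α)) := by
  obtain ⟨s, hs, hsτ⟩ := hτ.exists_section
  refine ⟨HuCohomology.opextEquivH2 G A, HuCohomology.opextEquivH2_mk_eq_iff,
    (QuotientGroup.quotientMulEquivOfEq (HuCohomology.ker_kernelClass hs hsτ).symm).trans
      (QuotientGroup.quotientKerEquivOfSurjective _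
        (HuCohomology.kernelClass_surjective hs hsτ hτ.projective)), fun α => ?_⟩
  exact ((HuCohomology.opextEquivH2_mk_eq_iff _ (HuCohomology.kernelCocycle A hs hsτ α)).2
    (HuCohomology.isFactorSet_extOf hs hsτ _ α)).symm
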